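/- For a real random variable $X$ and an integer $k\ge 1$ let $\mathbb E\,(X)_k=\mathbb E\,[X(X-1)\cdots(X-k+1)]$ denote its $k$th factorial moment. Let $(S_n)_{n\ge 1}$ be a sequence of real random variables having all moments, and let $c_{i,n}=\mathbb E\,(S_n)_i$, $i,n=1,2,\ldots$. Assume that $$\operatorname{Var} S_n\to\infty\qquad\text{and}\qquad \frac{\mathbb E\,S_n}{(\operatorname{Var} S_n)^{3/2}}\to 0\qquad (n\to\infty).$$ Suppose that there are real numbers $L_n$ ($n\ge 1$), real polynomials $Q^{(n)}_j$ ($n\ge 1$, $j\ge 2$) with $\deg Q^{(n)}_j\le j$, and a constant $C>0$ not depending on $n$ or $j$, such that $$|Q^{(n)}_j(i)|\le (Ci)^j\qquad\text{for all integers } i\ge 0,\ j\ge 2,\ n\ge 1$$ (in particular $Q^{(n)}_j(0)=0$), and such that for every integer $i\ge 1$ the identity $$c_{i,n}=L_n^i\exp\Big(\sum_{j\ge 1}\frac{Q^{(n)}_{j+1}(i)}{j\,n^j}\Big)$$ holds for all sufficiently large $n$ (how large may depend on $i$; by the preceding bound the series converges absolutely whenever $n>Ci$). Assume further that for every integer $J\ge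 3$ $$\frac{L_n^J}{n^{J-1}(\operatorname{Var} S_n)^{J/2}}\to 0\qquad (n\to\infty).$$ Then $$\frac{S_n-\mathbb E\,S_n}{\sqrt{\operatorname{Var} S_n}}\ \xrightarrow{\ d\ }\ \mathcal N(0,1)\qquad (n\to\infty).$$ -/

import Mathlib

open MeasureTheory ProbabilityTheory Filter Topology
open scoped ENNReal NNReal

/-- The `k`-th factorial moment `E (X)_k = E [X (X - 1) ⋯ (X - k + 1)]` of a real random variable.
`descPochhammer ℝ k` is the polynomial `x (x - 1) ⋯ (x - k + 1)`. -/
noncomputable def factorialMoment {Ω : Type*} [MeasurableSpace Ω] (X : Ω → ℝ) (k : ℕ)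
    (μ : Measure Ω) : ℝ :=
  ∫ ω, (descPochhammer ℝ k).eval (X ω) ∂μ

/-! Cumulant method, applied to factorial moments. Write the exponent of `c i` in Newton form, `∑ l,
i.choose l * γ l`. The `l`-th difference kills polynomials of degree below `l`, so only the terms of
order `n^{-(l-1)}` and smaller survive in `γ l` (`abs_newtonCoeff_tsum_le`). Hence `c i` is `L ^ i`
times the product of `exp (γ |e|)` over nonempty `e ⊆ [i]`. Expanding with `exp (γ l) = 1 + a l`
gives a sum over hypergraphs on `[i]`, and the factorial cumulants are the sums over connected
hypergraphs (`IsCumulantSeq.eq_connectedSum`). Connectedness on `J` vertices forces `∑ (|e| - 1) ≥ J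
- 1`, so the `J`-th factorial cumulant is `O(L ^ J / n ^ (J - 1))` (`exists_abs_cumulant_le`).

With `σ² = Var S`, the hypothesis on `L` makes these negligible against `σ ^ J` for `J ≥ 3`.
Centring adds multiples of the mean, negligible against `σ ^ 3`; it also makes the first cumulant
`0` and the second exactly `σ²`. So the rescaled factorial cumulants tend to those of a Gaussian,
and so do the rescaled factorial moments. Since `1 / σ → 0`, falling factorials may be replaced by
powers, and the method of moments concludes. -/

section Hypergraph

/-! ### Weighted hypergraphs and their connected components. -/

variable {α : Type*} [DecidableEq α]

/-- A set of vertices is closed for a hypergraph if it is a union of connected components. -/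
def IsEdgeClosed (H : Finset (Finset α)) (S : Finset α) : Prop :=
  ∀ e ∈ H, e ⊆ S ∨ Disjoint e S

/-- A hypergraph is connected on `B` if `B` is its only nonempty closed subset. -/
def IsConnectedOn (H : Finset (Finset α)) (B : Finset α) : Prop :=
  ∀ S ⊆ B, S.Nonempty → IsEdgeClosed H S → S = B

/-- The possible edges of a hypergraph on `B`. -/
def hyperedges (B : Finset α) : Finset (Finset α) := B.powerset.erase ∅

lemma mem_hyperedges {B e : Finset α} : e ∈ hyperedges B ↔ e.Nonempty ∧ e ⊆ B := by
  simp [hyperedges, Finset.nonempty_iff_ne_empty]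

/-- The weight of a hypergraph whose edges are weighted by their cardinality. -/
noncomputable def hyperWeight (a : ℕ → ℝ) (H : Finset (Finset α)) : ℝ := ∏ e ∈ H, a e.card

open scoped Classical in
/-- The total weight of the connected hypergraphs on `B`. -/
noncomputable def connectedSum (a : ℕ → ℝ) (B : Finset α) : ℝ :=
  ∑ H ∈ (hyperedges B).powerset with IsConnectedOn H B, hyperWeight a H

/-- The total weight of all hypergraphs on `B`. -/
noncomputable def hypergraphSum (a : ℕ → ℝ) (B : Finset α) : ℝ :=
  ∑ H ∈ (hyperedges B).powerset, hyperWeight a H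

lemma hypergraphSum_eq_prod (a : ℕ → ℝ) (B : Finset α) :
    hypergraphSum a B = ∏ e ∈ hyperedges B, (1 + a e.card) := by
  rw [Finset.prod_one_add]; rfl

/-- Each factor `1 + a |e|` is `exp (γ |e|)`, and there are `B.card.choose l` edges of size `l`. The
condition `γ 0 = 0` pays for the missing empty edge. -/
lemma hypergraphSum_exp_sub_one (γ : ℕ → ℝ) (h0 : γ 0 = 0) (B : Finset α) :
    hypergraphSum (fun l => Real.exp (γ l) - 1) B =
      Real.exp (∑ l ∈ Finset.range (B.card + 1), (B.card.choose l : ℝ) * γ l) := by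
  have h := Finset.sum_powerset_apply_card γ (x := B)
  simp only [nsmul_eq_mul] at h
  rw [hypergraphSum_eq_prod, ← h]
  simp only [add_sub_cancel]
  rw [← Real.exp_sum, hyperedges, Finset.sum_erase]
  simpa using h0

open scoped Classical in
/-- The connected component of `v` in a hypergraph on `A`. -/
noncomputable def hyperComponent (A : Finset α) (v : α) (H : Finset (Finset α)) : Finset α :=
  A.filter fun x : α => ∀ S ⊆ A, v ∈ S → IsEdgeClosed H S → x ∈ S

lemma hyperComponent_subset (A : Finset α) (v : α) (H : Finset (Finset α)) :
    hyperComponent A v H ⊆ A := by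
  simp [hyperComponent]

lemma mem_hyperComponent_self {A : Finset α} {v : α} (hv : v ∈ A) (H : Finset (Finset α)) :
    v ∈ hyperComponent A v H := by
  simp only [hyperComponent, Finset.mem_filter]
  exact ⟨hv, fun S _ h _ => h⟩

lemma hyperComponent_subset_of_isEdgeClosed {A S : Finset α} {v : α} {H : Finset (Finset α)}
    (hS : S ⊆ A) (hv : v ∈ S) (h : IsEdgeClosed H S) : hyperComponent A v H ⊆ S := by
  intro x hx
  simp only [hyperComponent, Finset.mem_filter] at hx
  exact hx.2 S hS hv h

lemma isEdgeClosed_hyperComponent {A : Finset α} (v : α) {H : Finset (Finset α)}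
    (hH : H ⊆ hyperedges A) : IsEdgeClosed H (hyperComponent A v H) := by
  intro e he
  by_cases hd : Disjoint e (hyperComponent A v H)
  · exact Or.inr hd
  left
  obtain ⟨x, hxe, hx⟩ := Finset.not_disjoint_iff.1 hd
  simp only [hyperComponent, Finset.mem_filter] at hx
  intro y hy
  simp only [hyperComponent, Finset.mem_filter]
  refine ⟨(mem_hyperedges.1 (hH he)).2 hy, fun S hS hv hc => ?_⟩
  rcases hc e he with h | h
  · exact h hy
  · exact absurd (hx.2 S hS hv hc) (Finset.disjoint_left.1 h hxe)

lemma hyperComponent_eq_iff {A B : Finset α} {v : α} {H : Finset (Finset α)}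
    (hH : H ⊆ hyperedges A) (hB : B ⊆ A) (hv : v ∈ B) :
    hyperComponent A v H = B ↔
      IsEdgeClosed H B ∧ IsConnectedOn (H.filter (· ⊆ B)) B := by
  constructor
  · intro h
    have hcl : IsEdgeClosed H B := h ▸ isEdgeClosed_hyperComponent v hH
    have key : ∀ S ⊆ B, v ∈ S → IsEdgeClosed (H.filter (· ⊆ B)) S → S = B := by
      intro S hS hvS hc
      refine hS.antisymm ?_
      rw [← h]
      refine hyperComponent_subset_of_isEdgeClosed (hS.trans hB) hvS fun e he => ?_
      rcases hcl e he with h1 | h1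
      · exact hc e (by simp [he, h1])
      · exact Or.inr (h1.mono_right hS)
    refine ⟨hcl, fun S hS hne hc => ?_⟩
    by_cases hvS : v ∈ S
    · exact key S hS hvS hc
    -- The complement of a closed set is closed and here contains `v`, so it is all of `B`, which
    -- leaves `S` empty.
    · have h2 : B \ S = B := by
        refine key _ Finset.sdiff_subset (by simp [hv, hvS]) fun e he => ?_
        have heB : e ⊆ B := (Finset.mem_filter.1 he).2
        rcases hc e he with h1 | h1
        · exact Or.inr (Finset.disjoint_sdiff.mono_left h1)
        · exact Or.inl (Finset.subset_sdiff.2 ⟨heB, h1⟩)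
      obtain ⟨x, hx⟩ := hne
      have := hS hx
      rw [← h2] at this
      simp [hx] at this
  · rintro ⟨hcl, hconn⟩
    refine hconn _ (hyperComponent_subset_of_isEdgeClosed hB hv hcl)
      ⟨v, mem_hyperComponent_self (hB hv) H⟩ fun e he => ?_
    exact isEdgeClosed_hyperComponent v hH e (Finset.mem_filter.1 he).1

-- When `B` is a component, every edge lies in `B` or in `A \ B`. Cutting a hypergraph along this
-- dichotomy is a bijection onto pairs, and the weight is multiplicative. Edges being nonempty, none
-- can lie on both sides.
open scoped Classical in
lemma sum_hyperComponent_eq (a : ℕ → ℝ) {A B : Finset α} {v : α} (hB : B ⊆ A) (hv : v ∈ B) :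
    ∑ H ∈ (hyperedges A).powerset with hyperComponent A v H = B, hyperWeight a H =
      connectedSum a B * hypergraphSum a (A \ B) := by
  rw [connectedSum, hypergraphSum, Finset.sum_mul_sum, ← Finset.sum_product']
  have hdisj : ∀ H₁ H₂ : Finset (Finset α), H₁ ⊆ hyperedges B → H₂ ⊆ hyperedges (A \ B) →
      Disjoint H₁ H₂ := by
    intro H₁ H₂ h₁ h₂
    rw [Finset.disjoint_left]
    intro e he₁ he₂
    have k₁ := mem_hyperedges.1 (h₁ he₁)
    have k₂ := mem_hyperedges.1 (h₂ he₂)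
    obtain ⟨x, hx⟩ := k₁.1
    exact (Finset.mem_sdiff.1 (k₂.2 hx)).2 (k₁.2 hx)
  have hf₁ : ∀ H₁ H₂ : Finset (Finset α), H₁ ⊆ hyperedges B → H₂ ⊆ hyperedges (A \ B) →
      (H₁ ∪ H₂).filter (· ⊆ B) = H₁ := by
    intro H₁ H₂ h₁ h₂
    ext e
    simp only [Finset.mem_filter, Finset.mem_union]
    constructor
    · rintro ⟨h | h, hs⟩
      · exact h
      · have k₂ := mem_hyperedges.1 (h₂ h)
        obtain ⟨x, hx⟩ := k₂.1
        exact absurd (hs hx) (Finset.mem_sdiff.1 (k₂.2 hx)).2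
    · exact fun h => ⟨Or.inl h, (mem_hyperedges.1 (h₁ h)).2⟩
  have hf₂ : ∀ H₁ H₂ : Finset (Finset α), H₁ ⊆ hyperedges B → H₂ ⊆ hyperedges (A \ B) →
      (H₁ ∪ H₂).filter (fun e => ¬ e ⊆ B) = H₂ := by
    intro H₁ H₂ h₁ h₂
    rw [Finset.filter_not, hf₁ H₁ H₂ h₁ h₂, Finset.union_sdiff_left]
    exact Finset.sdiff_eq_self_of_disjoint (hdisj H₁ H₂ h₁ h₂).symm
  refine Finset.sum_nbij' (fun H => (H.filter (· ⊆ B), H.filter (fun e => ¬ e ⊆ B)))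
    (fun p => p.1 ∪ p.2) ?_ ?_ ?_ ?_ ?_
  · intro H hH
    simp only [Finset.mem_filter, Finset.mem_powerset] at hH
    obtain ⟨hcl, hconn⟩ := (hyperComponent_eq_iff hH.1 hB hv).1 hH.2
    simp only [Finset.mem_product, Finset.mem_filter, Finset.mem_powerset]
    refine ⟨⟨fun e he => ?_, hconn⟩, fun e he => ?_⟩
    · rw [Finset.mem_filter] at he
      exact mem_hyperedges.2 ⟨(mem_hyperedges.1 (hH.1 he.1)).1, he.2⟩
    · rw [Finset.mem_filter] at he
      have := mem_hyperedges.1 (hH.1 he.1)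
      exact mem_hyperedges.2
        ⟨this.1, Finset.subset_sdiff.2 ⟨this.2, (hcl e he.1).resolve_left he.2⟩⟩
  · rintro ⟨H₁, H₂⟩ hp
    simp only [Finset.mem_product, Finset.mem_filter, Finset.mem_powerset] at hp
    obtain ⟨⟨h₁, hc⟩, h₂⟩ := hp
    have hsub : H₁ ∪ H₂ ⊆ hyperedges A := by
      refine Finset.union_subset (fun e he => ?_) (fun e he => ?_)
      · have := mem_hyperedges.1 (h₁ he)
        exact mem_hyperedges.2 ⟨this.1, this.2.trans hB⟩
      · have := mem_hyperedges.1 (h₂ he)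
        exact mem_hyperedges.2 ⟨this.1, this.2.trans Finset.sdiff_subset⟩
    simp only [Finset.mem_filter, Finset.mem_powerset]
    refine ⟨hsub, (hyperComponent_eq_iff hsub hB hv).2 ⟨fun e he => ?_, ?_⟩⟩
    · rcases Finset.mem_union.1 he with h | h
      · exact Or.inl (mem_hyperedges.1 (h₁ h)).2
      · exact Or.inr (Finset.subset_sdiff.1 (mem_hyperedges.1 (h₂ h)).2).2
    · rwa [hf₁ H₁ H₂ h₁ h₂]
  · intro H _
    exact Finset.filter_union_filter_not_eq _ H
  · rintro ⟨H₁, H₂⟩ hp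
    simp only [Finset.mem_product, Finset.mem_filter, Finset.mem_powerset] at hp
    obtain ⟨⟨h₁, hc⟩, h₂⟩ := hp
    exact Prod.ext (hf₁ H₁ H₂ h₁ h₂) (hf₂ H₁ H₂ h₁ h₂)
  · intro H _
    exact (Finset.prod_filter_mul_prod_filter_not H (· ⊆ B) _).symm

/-- Splitting off the connected component of a vertex. -/
lemma hypergraphSum_eq_sum_connectedSum (a : ℕ → ℝ) {A : Finset α} {v : α} (hv : v ∈ A) :
    hypergraphSum a A =
      ∑ B ∈ A.powerset with v ∈ B, connectedSum a B * hypergraphSum a (A \ B) := by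
  classical
  rw [hypergraphSum, ← Finset.sum_fiberwise_of_maps_to (g := hyperComponent A v)
    (t := A.powerset.filter (v ∈ ·))]
  · refine Finset.sum_congr rfl fun B hB => ?_
    simp only [Finset.mem_filter, Finset.mem_powerset] at hB
    exact sum_hyperComponent_eq a hB.1 hB.2
  · intro H _
    simp only [Finset.mem_filter, Finset.mem_powerset]
    exact ⟨hyperComponent_subset _ _ _, mem_hyperComponent_self hv H⟩

/-- A connected hypergraph on `B` has enough edges to span `B`. -/
lemma IsConnectedOn.card_le {H : Finset (Finset α)} {B : Finset α} (h : IsConnectedOn H B)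
    (hH : H ⊆ hyperedges B) (hB : B.Nonempty) :
    B.card ≤ 1 + ∑ e ∈ H, (e.card - 1) := by
  classical
  obtain ⟨v, hv⟩ := hB
  -- Grow a set satisfying the inequality from `{v}`. An edge that meets `S` without lying in it
  -- brings at most `|e| - 1` new vertices and raises the sum by at least `|e| - 1`, so a largest
  -- such `S` is closed.
  let P : Finset α → Prop := fun S =>
    S.Nonempty ∧ S.card ≤ 1 + ∑ e ∈ H with e ⊆ S, (e.card - 1)
  obtain ⟨S, hS, hmax⟩ := Finset.exists_max_image (B.powerset.filter P) Finset.card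
    ⟨{v}, by simp [P, hv]⟩
  simp only [Finset.mem_filter, Finset.mem_powerset, P] at hS hmax
  obtain ⟨hSB, hne, hcard⟩ := hS
  have hclosed : IsEdgeClosed H S := by
    intro e he
    by_contra! hcon
    obtain ⟨hnot, hd⟩ := hcon
    have heB := (mem_hyperedges.1 (hH he)).2
    have hi : 1 ≤ (e ∩ S).card := by
      rw [Finset.one_le_card]
      exact Finset.not_disjoint_iff_nonempty_inter.1 hd
    have hui := Finset.card_union_add_card_inter e S
    have hlt : (e ∩ S).card < e.card :=
      Finset.card_lt_card ⟨Finset.inter_subset_left,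
        fun hh => hnot (hh.trans Finset.inter_subset_right)⟩
    have hsum : (e.card - 1) + ∑ x ∈ H with x ⊆ S, (x.card - 1) ≤
        ∑ x ∈ H with x ⊆ e ∪ S, (x.card - 1) := by
      rw [← Finset.sum_insert (f := fun x : Finset α => x.card - 1) (by simp [hnot])]
      refine Finset.sum_le_sum_of_subset fun x hx => ?_
      rcases Finset.mem_insert.1 hx with rfl | hx
      · simp [he]
      · simp only [Finset.mem_filter] at hx ⊢
        exact ⟨hx.1, hx.2.trans Finset.subset_union_right⟩
    have := hmax (e ∪ S) ⟨Finset.union_subset heB hSB,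
      hne.mono Finset.subset_union_right, by omega⟩
    omega
  rw [h S hSB hne hclosed] at hcard
  exact hcard.trans (by gcongr; exact Finset.filter_subset _ _)

/-- There are at most `2 ^ 2 ^ |B|` hypergraphs, each with at most `2 ^ |B|` edges; by
`IsConnectedOn.card_le` the exponents of `ε` add up to at least `|B| - 1`. -/
lemma abs_connectedSum_le {a : ℕ → ℝ} {B : Finset α} (hB : B.Nonempty) {K ε : ℝ} (hK : 1 ≤ K)
    (hε0 : 0 ≤ ε) (hε1 : ε ≤ 1)
    (ha : ∀ l, 1 ≤ l → l ≤ B.card → |a l| ≤ K * ε ^ (l - 1)) :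
    |connectedSum a B| ≤ 2 ^ 2 ^ B.card * (K ^ 2 ^ B.card * ε ^ (B.card - 1)) := by
  classical
  have hcardE : (hyperedges B).card ≤ 2 ^ B.card := by
    rw [← Finset.card_powerset]; exact Finset.card_le_card (Finset.erase_subset _ _)
  have hterm : ∀ H ∈ (hyperedges B).powerset.filter (fun H => IsConnectedOn H B),
      |hyperWeight a H| ≤ K ^ 2 ^ B.card * ε ^ (B.card - 1) := by
    intro H hH
    simp only [Finset.mem_filter, Finset.mem_powerset] at hH
    have hc := hH.2.card_le hH.1 hB
    rw [hyperWeight, Finset.abs_prod]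
    calc ∏ e ∈ H, |a e.card| ≤ ∏ e ∈ H, (K * ε ^ (e.card - 1)) := by
          refine Finset.prod_le_prod (fun _ _ => abs_nonneg _) fun e he => ?_
          have := mem_hyperedges.1 (hH.1 he)
          exact ha _ (Finset.one_le_card.2 this.1) (Finset.card_le_card this.2)
      _ = K ^ H.card * ε ^ (∑ e ∈ H, (e.card - 1)) := by
          rw [Finset.prod_mul_distrib, Finset.prod_const, Finset.prod_pow_eq_pow_sum]
      _ ≤ _ := by
          have h1 : K ^ H.card ≤ K ^ 2 ^ B.card :=
            pow_le_pow_right₀ hK ((Finset.card_le_card hH.1).trans hcardE)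
          have h2 : ε ^ (∑ e ∈ H, (e.card - 1)) ≤ ε ^ (B.card - 1) :=
            pow_le_pow_of_le_one hε0 hε1 (by omega)
          gcongr
  calc |connectedSum a B| ≤ _ := Finset.abs_sum_le_sum_abs _ _
    _ ≤ _ := Finset.sum_le_sum hterm
    _ ≤ _ := by
      rw [Finset.sum_const, nsmul_eq_mul]
      gcongr
      calc ((((hyperedges B).powerset.filter (fun H => IsConnectedOn H B)).card : ℕ) : ℝ)
          ≤ ((2 ^ 2 ^ B.card : ℕ) : ℝ) := by
            norm_cast
            refine (Finset.card_le_card (Finset.filter_subset _ _)).trans ?_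
            rw [Finset.card_powerset]
            exact Nat.pow_le_pow_right (by norm_num) hcardE
        _ = _ := by push_cast; rfl

end Hypergraph

/-! ### Cumulants as sums over connected hypergraphs. -/

/-- The sequence `f` consists of the cumulants attached to the moment sequence `c`. -/
def IsCumulantSeq (c f : ℕ → ℝ) : Prop :=
  c 0 = 1 ∧ ∀ n, c (n + 1) = ∑ k ∈ Finset.range (n + 1), (n.choose k : ℝ) * (f (k + 1) * c (n - k))

/-- Removing `v` from `B` turns the sum into one over subsets of size `k` of the other vertices. The
recursion thus takes the same shape as `hypergraphSum_eq_sum_connectedSum`. -/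
lemma IsCumulantSeq.sum_powerset {c f : ℕ → ℝ} (h : IsCumulantSeq c f) {α : Type*} [DecidableEq α]
    {A : Finset α} {v : α} (hv : v ∈ A) :
    c A.card = ∑ B ∈ A.powerset with v ∈ B, f B.card * c (A \ B).card := by
  obtain ⟨A, hvA, rfl⟩ : ∃ A', v ∉ A' ∧ insert v A' = A :=
    ⟨A.erase v, Finset.notMem_erase _ _, Finset.insert_erase hv⟩
  have h1 : ∑ B ∈ (insert v A).powerset with v ∈ B, f B.card * c (insert v A \ B).card =
      ∑ B ∈ A.powerset, f (B.card + 1) * c (A.card - B.card) := by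
    symm
    refine Finset.sum_nbij' (insert v ·) (·.erase v) ?_ ?_ ?_ ?_ ?_
    · intro B hB
      simp only [Finset.mem_powerset, Finset.mem_filter] at *
      exact ⟨Finset.insert_subset_insert _ hB, by simp⟩
    · intro B hB
      simp only [Finset.mem_powerset, Finset.mem_filter] at *
      exact Finset.subset_insert_iff.1 hB.1
    · intro B hB
      exact Finset.erase_insert fun hh => hvA (Finset.mem_powerset.1 hB hh)
    · intro B hB
      exact Finset.insert_erase (Finset.mem_filter.1 hB).2
    · intro B hB
      have hB := Finset.mem_powerset.1 hB
      have hvB : v ∉ B := fun hh => hvA (hB hh)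
      rw [Finset.card_insert_of_notMem hvB, Finset.card_sdiff_of_subset
        (Finset.insert_subset_insert _ hB), Finset.card_insert_of_notMem hvA,
        Finset.card_insert_of_notMem hvB, Nat.add_sub_add_right]
  rw [h1, Finset.card_insert_of_notMem hvA, h.2, Finset.sum_powerset_apply_card
    (fun k => f (k + 1) * c (A.card - k))]
  simp

/-- If moments are given by weighted hypergraphs, then cumulants are given by connected ones. -/
lemma IsCumulantSeq.eq_connectedSum {c f : ℕ → ℝ} (h : IsCumulantSeq c f) {a : ℕ → ℝ} {L : ℝ}
    {α : Type*} [DecidableEq α] {J : ℕ}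
    (hc : ∀ A : Finset α, A.card ≤ J → c A.card = L ^ A.card * hypergraphSum a A)
    (A : Finset α) (hA : A.Nonempty) (hAJ : A.card ≤ J) :
    f A.card = L ^ A.card * connectedSum a A := by
  induction A using Finset.strongInduction with
  | H A ih =>
    obtain ⟨v, hv⟩ := hA
    have hmem : A ∈ A.powerset.filter (v ∈ ·) := by simp [hv]
    have h1 := h.sum_powerset hv
    have h2 := hc A hAJ
    -- Both recursions run over the sets `B` containing `v`. Terms with `B ≠ A` agree by induction,
    -- which leaves the terms `B = A`.
    rw [hypergraphSum_eq_sum_connectedSum a hv, h1, ← Finset.add_sum_erase _ _ hmem,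
      ← Finset.add_sum_erase _ _ hmem, mul_add, Finset.mul_sum] at h2
    have h3 : ∑ B ∈ (A.powerset.filter (v ∈ ·)).erase A, f B.card * c (A \ B).card =
        ∑ B ∈ (A.powerset.filter (v ∈ ·)).erase A,
          L ^ A.card * (connectedSum a B * hypergraphSum a (A \ B)) := by
      refine Finset.sum_congr rfl fun B hB => ?_
      simp only [Finset.mem_erase, Finset.mem_filter, Finset.mem_powerset] at hB
      obtain ⟨hne, hBA, hvB⟩ := hB
      have hle := Finset.card_le_card hBA
      rw [ih B (hBA.ssubset_of_ne hne) ⟨v, hvB⟩ (hle.trans hAJ),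
        hc (A \ B) ((Finset.card_le_card Finset.sdiff_subset).trans hAJ),
        ← Finset.card_sdiff_add_card_eq_card hBA, pow_add]
      ring
    have h4 : hypergraphSum a (∅ : Finset α) = 1 := by
      simp [hypergraphSum_eq_prod, hyperedges]
    rw [h3] at h2
    simpa [h.1, h4] using add_right_cancel h2

lemma IsCumulantSeq.abs_le {c f : ℕ → ℝ} (h : IsCumulantSeq c f) {γ : ℕ → ℝ} {L K ε : ℝ} {J : ℕ}
    (hJ : 1 ≤ J) (h0 : γ 0 = 0)
    (hc : ∀ i ≤ J, c i =
      L ^ i * Real.exp (∑ l ∈ Finset.range (i + 1), (i.choose l : ℝ) * γ l))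
    (hK : 1 ≤ K) (hε0 : 0 ≤ ε) (hε1 : ε ≤ 1)
    (hγ : ∀ l, 1 ≤ l → l ≤ J → |Real.exp (γ l) - 1| ≤ K * ε ^ (l - 1)) :
    |f J| ≤ |L| ^ J * (2 ^ 2 ^ J * (K ^ 2 ^ J * ε ^ (J - 1))) := by
  have hcard := Finset.card_range J
  have hne : (Finset.range J).Nonempty := by simp; omega
  have h1 := h.eq_connectedSum (a := fun l => Real.exp (γ l) - 1) (L := L) (J := J)
    (fun A hA => by rw [hypergraphSum_exp_sub_one γ h0, hc _ hA]) (Finset.range J) hne hcard.le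
  have h2 := abs_connectedSum_le (a := fun l => Real.exp (γ l) - 1) hne hK hε0 hε1
    (by simpa using hγ)
  rw [hcard] at h1 h2
  rw [h1, abs_mul, abs_pow]
  gcongr

/-! ### Newton expansion of the exponent and the cumulant bound. -/

/-- Newton's forward difference coefficients of a sequence at `0`. -/
noncomputable def newtonCoeff (g : ℕ → ℝ) (l : ℕ) : ℝ := (fwdDiff (1 : ℕ))^[l] g 0

lemma newtonCoeff_eq_sum (g : ℕ → ℝ) (l : ℕ) :
    newtonCoeff g l =
      ∑ k ∈ Finset.range (l + 1), (((-1 : ℤ) ^ (l - k) * l.choose k : ℤ) : ℝ) * g k := by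
  rw [newtonCoeff, fwdDiff_iter_eq_sum_shift]
  simp

lemma eq_sum_choose_mul_newtonCoeff (g : ℕ → ℝ) (i : ℕ) :
    g i = ∑ l ∈ Finset.range (i + 1), (i.choose l : ℝ) * newtonCoeff g l := by
  have h := shift_eq_sum_fwdDiff_iter (1 : ℕ) g i 0
  simpa [newtonCoeff] using h

lemma newtonCoeff_polynomial_eq_zero (P : Polynomial ℝ) {l : ℕ} (h : P.natDegree < l) :
    newtonCoeff (fun i => P.eval (i : ℝ)) l = 0 := by
  have h1 := congrFun (Polynomial.fwdDiff_iter_eq_zero_of_degree_lt h) (0 : ℝ)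
  rw [fwdDiff_iter_eq_sum_shift] at h1
  rw [newtonCoeff, fwdDiff_iter_eq_sum_shift]
  simpa using h1

lemma abs_newtonCoeff_le {g : ℕ → ℝ} {l : ℕ} {b : ℝ} (h : ∀ i ≤ l, |g i| ≤ b) :
    |newtonCoeff g l| ≤ 2 ^ l * b := by
  rw [newtonCoeff_eq_sum]
  calc _ ≤ ∑ k ∈ Finset.range (l + 1), |(((-1 : ℤ) ^ (l - k) * l.choose k : ℤ) : ℝ) * g k| :=
        Finset.abs_sum_le_sum_abs _ _
    _ ≤ ∑ k ∈ Finset.range (l + 1), (l.choose k : ℝ) * b := by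
        refine Finset.sum_le_sum fun k hk => ?_
        rw [abs_mul]
        push_cast
        rw [abs_mul, abs_pow, abs_neg, abs_one, one_pow, one_mul, Nat.abs_cast]
        gcongr
        exact h k (Finset.mem_range_succ_iff.1 hk)
    _ = 2 ^ l * b := by
        rw [← Finset.sum_mul]
        congr 1
        exact_mod_cast Nat.sum_range_choose l

lemma summable_half_pow_succ : Summable fun j : ℕ => ((1 : ℝ) / 2) ^ (j + 1) :=
  (summable_nat_add_iff 1).2 summable_geometric_two

lemma tsum_half_pow_succ : ∑' j : ℕ, ((1 : ℝ) / 2) ^ (j + 1) = 1 := by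
  simp_rw [pow_succ, tsum_mul_right, tsum_geometric_two]
  norm_num

/-- Polynomials of degree at most `j + 2` in the coefficient of `n⁻⁽ʲ⁺¹⁾` only contribute terms of
order `n⁻⁽ˡ⁻¹⁾` to the `l`-th difference. -/
lemma abs_newtonCoeff_tsum_le {q : ℕ → Polynomial ℝ} {B : ℝ} {n l : ℕ} (hB : 0 < B)
    (hn : 2 * B ≤ n) (hdeg : ∀ j, (q j).natDegree ≤ j + 2)
    (hq : ∀ j, ∀ i ≤ l, |(q j).eval (i : ℝ)| ≤ B ^ (j + 2)) :
    |newtonCoeff (fun i => ∑' j : ℕ, (q j).eval (i : ℝ) / (((j : ℝ) + 1) * (n : ℝ) ^ (j + 1))) l|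
      ≤ 2 ^ l * B * (2 * B / n) ^ (l - 1) := by
  have hn0 : (0 : ℝ) < n := by linarith
  have hx0 : 0 ≤ 2 * B / n := by positivity
  have hx1 : 2 * B / n ≤ 1 := (div_le_one hn0).2 hn
  -- Split `B / n` as `(2 * B / n) * (1 / 2)`: the first factor carries the decay in `n`, the second
  -- makes the series converge.
  have hterm : ∀ j, ∀ i ≤ l, |(q j).eval (i : ℝ) / (((j : ℝ) + 1) * (n : ℝ) ^ (j + 1))| ≤
      B * ((2 * B / n) ^ (j + 1) * (1 / 2) ^ (j + 1)) := by
    intro j i hi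
    rw [abs_div, abs_of_pos (show (0 : ℝ) < ((j : ℝ) + 1) * (n : ℝ) ^ (j + 1) by positivity),
      ← mul_pow, show 2 * B / n * (1 / 2) = B / n by ring, div_pow, ← mul_div_assoc, ← pow_succ']
    refine div_le_div₀ (by positivity) (hq j i hi) (by positivity) ?_
    exact le_mul_of_one_le_left (by positivity) (by linarith [(Nat.cast_nonneg j : (0 : ℝ) ≤ j)])
  have hsum : ∀ i ≤ l,
      Summable fun j : ℕ => (q j).eval (i : ℝ) / (((j : ℝ) + 1) * (n : ℝ) ^ (j + 1)) := by
    intro i hi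
    refine Summable.of_norm_bounded (summable_half_pow_succ.mul_left B) fun j => ?_
    refine (hterm j i hi).trans ?_
    gcongr
    exact mul_le_of_le_one_left (by positivity) (pow_le_one₀ hx0 hx1)
  have heq : newtonCoeff
      (fun i => ∑' j : ℕ, (q j).eval (i : ℝ) / (((j : ℝ) + 1) * (n : ℝ) ^ (j + 1))) l =
      ∑' j : ℕ, newtonCoeff
        (fun i => (q j).eval (i : ℝ) / (((j : ℝ) + 1) * (n : ℝ) ^ (j + 1))) l := by
    simp_rw [newtonCoeff_eq_sum]
    rw [Summable.tsum_finsetSum fun k hk =>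
      (hsum k (Finset.mem_range_succ_iff.1 hk)).mul_left _]
    simp_rw [tsum_mul_left]
  have hbound : ∀ j : ℕ, ‖newtonCoeff
        (fun i => (q j).eval (i : ℝ) / (((j : ℝ) + 1) * (n : ℝ) ^ (j + 1))) l‖ ≤
      2 ^ l * B * (2 * B / n) ^ (l - 1) * (1 / 2) ^ (j + 1) := by
    intro j
    -- Either the degree is below `l` and the difference vanishes, or `j + 1 ≥ l - 1` and the term
    -- is already small enough.
    rcases lt_or_ge (j + 2) l with hj | hj
    · have h0 := newtonCoeff_polynomial_eq_zero (q j) ((hdeg j).trans_lt hj)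
      have h1 : newtonCoeff
          (fun i => (q j).eval (i : ℝ) / (((j : ℝ) + 1) * (n : ℝ) ^ (j + 1))) l = 0 := by
        rw [newtonCoeff_eq_sum] at h0 ⊢
        simp_rw [← mul_div_assoc]
        rw [← Finset.sum_div, h0, zero_div]
      rw [h1, norm_zero]
      positivity
    · refine (abs_newtonCoeff_le (hterm j)).trans ?_
      have : (2 * B / n) ^ (j + 1) ≤ (2 * B / n) ^ (l - 1) :=
        pow_le_pow_of_le_one hx0 hx1 (by omega)
      calc _ ≤ 2 ^ l * (B * ((2 * B / n) ^ (l - 1) * (1 / 2) ^ (j + 1))) := by gcongr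
        _ = _ := by ring
  rw [heq, ← Real.norm_eq_abs]
  refine (tsum_of_norm_bounded
    ((summable_half_pow_succ.hasSum).mul_left (2 ^ l * B * (2 * B / n) ^ (l - 1))) hbound).trans ?_
  rw [tsum_half_pow_succ, mul_one]

lemma abs_exp_sub_one_le_mul_exp {x M : ℝ} (h : |x| ≤ M) :
    |Real.exp x - 1| ≤ |x| * Real.exp M := by
  have hM : Real.exp |x| ≤ Real.exp M := Real.exp_le_exp.2 h
  have h1 : |Real.exp x - 1| ≤ |x| * Real.exp |x| := by
    have h2 := Real.add_one_le_exp x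
    have h3 := Real.add_one_le_exp (-x)
    have h4 : Real.exp (-x) * Real.exp x = 1 := by rw [← Real.exp_add]; simp
    have h5 := Real.exp_pos x
    rcases le_total 0 x with hx | hx
    · rw [abs_of_nonneg hx, abs_of_nonneg (by linarith)]
      nlinarith
    · have h6 : Real.exp x ≤ 1 := Real.exp_le_one_iff.2 hx
      rw [abs_of_nonpos (by linarith : Real.exp x - 1 ≤ 0)]
      have h7 : 1 ≤ Real.exp |x| := Real.one_le_exp (abs_nonneg x)
      have h8 : |x| = -x := abs_of_nonpos hx
      nlinarith [abs_nonneg x]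
  exact h1.trans (by gcongr)

/-- Cumulants of order `J` are of order `Lᴶ n^{-(J-1)}`. -/
lemma exists_abs_cumulant_le {c f : ℕ → ℕ → ℝ} {L : ℕ → ℝ} {Q : ℕ → ℕ → Polynomial ℝ} {C : ℝ}
    (hC : 0 < C) (hcf : ∀ n, 1 ≤ n → IsCumulantSeq (c n) (f n))
    (hdeg : ∀ n, 1 ≤ n → ∀ j, 2 ≤ j → (Q n j).natDegree ≤ j)
    (hbound : ∀ n, 1 ≤ n → ∀ j, 2 ≤ j → ∀ i : ℕ, |(Q n j).eval (i : ℝ)| ≤ (C * i) ^ j)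
    (hfact : ∀ i : ℕ, 1 ≤ i → ∀ᶠ n : ℕ in atTop,
      c n i = L n ^ i * Real.exp
          (∑' j : ℕ, (Q n (j + 2)).eval (i : ℝ) / (((j : ℝ) + 1) * (n : ℝ) ^ (j + 1))))
    (J : ℕ) (hJ : 1 ≤ J) :
    ∃ K : ℝ, ∀ᶠ n : ℕ in atTop, |f n J| ≤ K * |L n ^ J / (n : ℝ) ^ (J - 1)| := by
  set B : ℝ := C * J + 1 with hBdef
  have hB : 0 < B := by positivity
  have hB1 : 1 ≤ B := by rw [hBdef]; nlinarith [(Nat.cast_nonneg J : (0 : ℝ) ≤ J)]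
  -- `2 ^ J * B` bounds every `γ l` with `l ≤ J`, so its exponential is the price of passing from `γ
  -- l` to `exp (γ l) - 1`. The summand `1` ensures `1 ≤ K`.
  set K : ℝ := 1 + 2 ^ J * B * (2 * B) ^ J * Real.exp (2 ^ J * B) with hKdef
  refine ⟨2 ^ 2 ^ J * K ^ 2 ^ J, ?_⟩
  have hall : ∀ᶠ n : ℕ in atTop, ∀ i ∈ Finset.Icc 1 J, c n i = L n ^ i * Real.exp
      (∑' j : ℕ, (Q n (j + 2)).eval (i : ℝ) / (((j : ℝ) + 1) * (n : ℝ) ^ (j + 1))) :=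
    (Filter.eventually_all_finset _).2 fun i hi => hfact i (Finset.mem_Icc.1 hi).1
  filter_upwards [hall, eventually_ge_atTop 1,
    tendsto_natCast_atTop_atTop.eventually_ge_atTop (2 * B)] with n hn hn1 hnB
  have hn0 : (0 : ℝ) < n := by exact_mod_cast hn1
  set g : ℕ → ℝ := fun i =>
    ∑' j : ℕ, (Q n (j + 2)).eval (i : ℝ) / (((j : ℝ) + 1) * (n : ℝ) ^ (j + 1)) with hg
  have hQ0 : ∀ j, (Q n (j + 2)).eval ((0 : ℕ) : ℝ) = 0 := by
    intro j
    have := hbound n hn1 (j + 2) (by omega) 0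
    simpa using this
  -- Gives both `γ 0 = 0` and the moment identity at `i = 0`, which `hfact` does not cover.
  have hg0 : g 0 = 0 := by
    simp only [hg]
    simp_rw [hQ0]
    simp
  have hγ : ∀ l ≤ J, |newtonCoeff g l| ≤ 2 ^ l * B * (2 * B / n) ^ (l - 1) := by
    intro l hl
    refine abs_newtonCoeff_tsum_le hB hnB (fun j => hdeg n hn1 _ (by omega)) fun j i hi => ?_
    refine (hbound n hn1 (j + 2) (by omega) i).trans ?_
    have : (i : ℝ) ≤ J := by exact_mod_cast hi.trans hl
    have : C * i ≤ B := by rw [hBdef]; nlinarith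
    gcongr
  have hx1 : 2 * B / n ≤ 1 := (div_le_one hn0).2 hnB
  have hx0 : 0 ≤ 2 * B / n := by positivity
  have key := (hcf n hn1).abs_le (γ := newtonCoeff g) (L := L n) (K := K) (ε := 1 / n) hJ
    (by simpa [newtonCoeff] using hg0) (fun i hi => by
      rw [← eq_sum_choose_mul_newtonCoeff]
      rcases Nat.eq_zero_or_pos i with rfl | hi0
      · simp [hg0, (hcf n hn1).1]
      · exact hn i (Finset.mem_Icc.2 ⟨hi0, hi⟩))
    (by rw [hKdef]; have : 0 ≤ 2 ^ J * B * (2 * B) ^ J * Real.exp (2 ^ J * B) := by positivity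
        linarith)
    (by positivity)
    (by rw [div_le_one hn0]; exact_mod_cast hn1) (fun l hl1 hlJ => by
      have h1 := hγ l hlJ
      have h2 : (2 : ℝ) ^ l ≤ 2 ^ J := pow_le_pow_right₀ (by norm_num) hlJ
      have h3 : (2 * B / n) ^ (l - 1) ≤ 1 := pow_le_one₀ hx0 hx1
      have h4 : |newtonCoeff g l| ≤ 2 ^ J * B := by
        refine h1.trans ?_
        calc _ ≤ 2 ^ J * B * 1 := by gcongr
          _ = _ := mul_one _
      have h5 : (2 * B) ^ (l - 1) ≤ (2 * B) ^ J :=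
        pow_le_pow_right₀ (by linarith) (by omega)
      calc |Real.exp (newtonCoeff g l) - 1| ≤ |newtonCoeff g l| * Real.exp (2 ^ J * B) :=
            abs_exp_sub_one_le_mul_exp h4
        _ ≤ (2 ^ l * B * (2 * B / n) ^ (l - 1)) * Real.exp (2 ^ J * B) := by gcongr
        _ = (2 ^ l * B * (2 * B) ^ (l - 1) * Real.exp (2 ^ J * B)) * (1 / n) ^ (l - 1) := by
            rw [div_eq_mul_one_div (2 * B), mul_pow]; ring
        _ ≤ (2 ^ J * B * (2 * B) ^ J * Real.exp (2 ^ J * B)) * (1 / n) ^ (l - 1) := by gcongr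
        _ ≤ K * (1 / n) ^ (l - 1) := by gcongr; rw [hKdef]; linarith)
  refine key.trans_eq ?_
  rw [abs_div, abs_pow, abs_pow, abs_of_pos hn0, div_pow, one_pow]
  ring

/-! ### Existence, additivity and continuity of cumulants. -/

/-- The exponential generating function of a sequence. -/
noncomputable def egf (u : ℕ → ℝ) : PowerSeries ℝ := PowerSeries.mk fun k => u k / (k.factorial : ℝ)

lemma coeff_egf_mul_egf (u v : ℕ → ℝ) (n : ℕ) :
    PowerSeries.coeff n (egf u * egf v) =
      (∑ k ∈ Finset.range (n + 1), (n.choose k : ℝ) * (u k * v (n - k))) / (n.factorial : ℝ) := by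
  rw [PowerSeries.coeff_mul, Finset.Nat.sum_antidiagonal_eq_sum_range_succ_mk, Finset.sum_div]
  refine Finset.sum_congr rfl fun k hk => ?_
  have hk : k ≤ n := Finset.mem_range_succ_iff.1 hk
  simp only [egf, PowerSeries.coeff_mk]
  rw [Nat.cast_choose ℝ hk]
  have h1 : (k.factorial : ℝ) ≠ 0 := by positivity
  have h2 : ((n - k).factorial : ℝ) ≠ 0 := by positivity
  have h3 : (n.factorial : ℝ) ≠ 0 := by positivity
  field_simp

lemma coeff_derivative_egf (u : ℕ → ℝ) (n : ℕ) :
    PowerSeries.coeff n (PowerSeries.derivative ℝ (egf u)) = u (n + 1) / (n.factorial : ℝ) := by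
  rw [PowerSeries.coeff_derivative, egf, PowerSeries.coeff_mk, Nat.factorial_succ]
  push_cast
  have h3 : (n.factorial : ℝ) ≠ 0 := by positivity
  have h4 : (n : ℝ) + 1 ≠ 0 := by positivity
  field_simp

lemma isCumulantSeq_iff_egf {c f : ℕ → ℝ} :
    IsCumulantSeq c f ↔ c 0 = 1 ∧
      PowerSeries.derivative ℝ (egf c) = egf (fun k => f (k + 1)) * egf c := by
  refine and_congr_right fun _ => ?_
  rw [PowerSeries.ext_iff]
  refine forall_congr' fun n => ?_
  rw [coeff_derivative_egf, coeff_egf_mul_egf, div_left_inj' (by positivity)]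

/-- The generating function of the shifted cumulants is the logarithmic derivative of `egf c`, which
exists because the constant coefficient is `1`. The value at `k = 0` never enters the recursion. -/
lemma exists_isCumulantSeq {c : ℕ → ℝ} (h0 : c 0 = 1) : ∃ f, IsCumulantSeq c f := by
  set F := PowerSeries.derivative ℝ (egf c) * (egf c)⁻¹ with hF
  refine ⟨fun k => (k - 1).factorial * PowerSeries.coeff (k - 1) F, isCumulantSeq_iff_egf.2 ⟨h0, ?_⟩⟩
  have h1 : egf (fun k => ((k + 1 - 1).factorial : ℝ) * PowerSeries.coeff (k + 1 - 1) F) = F := by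
    ext k
    simp only [egf, PowerSeries.coeff_mk, Nat.add_sub_cancel]
    have h3 : (k.factorial : ℝ) ≠ 0 := by positivity
    field_simp
  rw [h1, hF, mul_assoc, PowerSeries.inv_mul_cancel, mul_one]
  simp [egf, h0]

/-- The cumulants of a binomial convolution add up. -/
lemma IsCumulantSeq.binomialConvolution {c f d h : ℕ → ℝ} (hc : IsCumulantSeq c f)
    (hd : IsCumulantSeq d h) :
    IsCumulantSeq (fun n => ∑ k ∈ Finset.range (n + 1), (n.choose k : ℝ) * (c k * d (n - k)))
      (fun k => f k + h k) := by
  have h1 : egf (fun n => ∑ k ∈ Finset.range (n + 1), (n.choose k : ℝ) * (c k * d (n - k))) =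
      egf c * egf d := by
    ext n
    rw [coeff_egf_mul_egf, egf, PowerSeries.coeff_mk]
  have h2 : egf (fun k => f (k + 1) + h (k + 1)) =
      egf (fun k => f (k + 1)) + egf (fun k => h (k + 1)) := by
    ext n
    simp [egf, add_div]
  rw [isCumulantSeq_iff_egf] at hc hd ⊢
  refine ⟨by simp [hc.1, hd.1], ?_⟩
  rw [h1, h2, Derivation.leibniz, hc.2, hd.2]
  simp only [smul_eq_mul]
  ring

lemma IsCumulantSeq.scale {c f : ℕ → ℝ} (h : IsCumulantSeq c f) (δ : ℝ) :
    IsCumulantSeq (fun n => δ ^ n * c n) (fun k => δ ^ k * f k) := by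
  refine ⟨by simp [h.1], fun n => ?_⟩
  simp only [h.2 n]
  rw [Finset.mul_sum]
  refine Finset.sum_congr rfl fun k hk => ?_
  have hk : k ≤ n := Finset.mem_range_succ_iff.1 hk
  have : δ ^ (n + 1) = δ ^ (k + 1) * δ ^ (n - k) := by rw [← pow_add]; congr 1; omega
  rw [this]
  ring

/-- Moments depend continuously on cumulants. -/
lemma tendsto_of_tendsto_cumulant {ι : Type*} {l : Filter ι} {c f : ι → ℕ → ℝ} {g κ : ℕ → ℝ}
    (hcf : ∀ᶠ n in l, IsCumulantSeq (c n) (f n)) (hg : IsCumulantSeq g κ)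
    (h : ∀ k, 1 ≤ k → Tendsto (fun n => f n k) l (𝓝 (κ k))) (m : ℕ) :
    Tendsto (fun n => c n m) l (𝓝 (g m)) := by
  induction m using Nat.strong_induction_on with
  | _ m ih =>
    cases m with
    | zero =>
      rw [hg.1]
      exact tendsto_const_nhds.congr' (hcf.mono fun n hn => hn.1.symm)
    | succ m =>
      rw [hg.2]
      refine Tendsto.congr' (hcf.mono fun n hn => (hn.2 m).symm) ?_
      exact tendsto_finsetSum _ fun k _ =>
        ((h (k + 1) (by omega)).mul (ih (m - k) (by omega))).const_mul _

/-! ### Factorial moments, centring, and the return to ordinary moments. -/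

section FactorialMoments

lemma descPochhammer_smeval_eq_eval (n : ℕ) (x : ℝ) :
    (descPochhammer ℤ n).smeval x = (descPochhammer ℝ n).eval x := by
  rw [← Polynomial.aeval_eq_smeval, ← descPochhammer_map (algebraMap ℤ ℝ),
    Polynomial.eval_map_algebraMap]

/-- The Chu-Vandermonde identity for real falling factorials. -/
lemma descPochhammer_eval_add (n : ℕ) (x y : ℝ) :
    (descPochhammer ℝ n).eval (x + y) = ∑ k ∈ Finset.range (n + 1),
      (n.choose k : ℝ) * ((descPochhammer ℝ k).eval x * (descPochhammer ℝ (n - k)).eval y) := by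
  have h := Ring.descPochhammer_smeval_add n (Commute.all x y)
  simp only [descPochhammer_smeval_eq_eval] at h
  rw [h, Finset.Nat.sum_antidiagonal_eq_sum_range_succ_mk]

lemma descPochhammer_eval_neg_one (n : ℕ) :
    (descPochhammer ℝ n).eval (-1) = (-1) ^ n * (n.factorial : ℝ) := by
  induction n with
  | zero => simp
  | succ n ih =>
    rw [descPochhammer_succ_eval, ih, Nat.factorial_succ]
    push_cast
    ring

/-- These are the factorial cumulants of the constant `r`: the generating function is `(1 + x) ^ r`,
with logarithm `r * log (1 + x)`. The recursion is Chu-Vandermonde applied to `r - 1 = -1 + r`. -/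
lemma isCumulantSeq_descPochhammer (r : ℝ) :
    IsCumulantSeq (fun n => (descPochhammer ℝ n).eval r)
      (fun k => r * ((-1) ^ (k - 1) * ((k - 1).factorial : ℝ))) := by
  refine ⟨by simp, fun n => ?_⟩
  have h : (descPochhammer ℝ (n + 1)).eval r = r * (descPochhammer ℝ n).eval (-1 + r) := by
    rw [descPochhammer_succ_left]
    simp [neg_add_eq_sub]
  simp only [h]
  rw [descPochhammer_eval_add, Finset.mul_sum]
  refine Finset.sum_congr rfl fun k _ => ?_
  rw [descPochhammer_eval_neg_one, Nat.add_sub_cancel]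
  ring

variable {Ω : Type*} [MeasurableSpace Ω] {μ : Measure Ω} {X : Ω → ℝ}

lemma integrable_pow_of_memLp [IsFiniteMeasure μ] (h : ∀ k : ℕ, MemLp X (k : ℝ≥0∞) μ) (k : ℕ) :
    Integrable (fun ω => X ω ^ k) μ := by
  refine (integrable_norm_iff ((h k).aestronglyMeasurable.pow k)).1 ?_
  simpa using (h k).integrable_norm_pow'

lemma integrable_eval_of_integrable_pow (h : ∀ k : ℕ, Integrable (fun ω => X ω ^ k) μ)
    (p : Polynomial ℝ) : Integrable (fun ω => p.eval (X ω)) μ := by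
  simp_rw [Polynomial.eval_eq_sum_range]
  exact integrable_finsetSum _ fun k _ => (h k).const_mul _

lemma factorialMoment_zero [IsProbabilityMeasure μ] : factorialMoment X 0 μ = 1 := by
  simp [factorialMoment]

lemma factorialMoment_one : factorialMoment X 1 μ = ∫ ω, X ω ∂μ := by
  simp [factorialMoment]

lemma factorialMoment_add_const (h : ∀ k : ℕ, Integrable (fun ω => X ω ^ k) μ) (r : ℝ) (n : ℕ) :
    factorialMoment (fun ω => X ω + r) n μ = ∑ k ∈ Finset.range (n + 1),
      (n.choose k : ℝ) * (factorialMoment X k μ * (descPochhammer ℝ (n - k)).eval r) := by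
  simp only [factorialMoment, descPochhammer_eval_add]
  rw [integral_finsetSum _ fun k _ =>
    ((integrable_eval_of_integrable_pow h _).mul_const _).const_mul _]
  simp_rw [integral_const_mul, integral_mul_const]

/-- The factorial cumulants of a shifted random variable. -/
lemma IsCumulantSeq.factorialMoment_sub_const {f : ℕ → ℝ}
    (hf : IsCumulantSeq (fun k => factorialMoment X k μ) f)
    (h : ∀ k : ℕ, Integrable (fun ω => X ω ^ k) μ) (r : ℝ) :
    IsCumulantSeq (fun k => factorialMoment (fun ω => X ω - r) k μ)
      (fun k => f k - r * ((-1) ^ (k - 1) * ((k - 1).factorial : ℝ))) := by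
  have h1 := hf.binomialConvolution (isCumulantSeq_descPochhammer (-r))
  simp_rw [← factorialMoment_add_const h] at h1
  simpa [sub_eq_add_neg] using h1

lemma IsCumulantSeq.factorialMoment_apply_one {f : ℕ → ℝ}
    (hf : IsCumulantSeq (fun k => factorialMoment X k μ) f) : f 1 = ∫ ω, X ω ∂μ := by
  have h1 := hf.2 0
  have h0 := hf.1
  simp only [factorialMoment_one, zero_add] at h1 h0
  simp [h0] at h1
  exact h1.symm

lemma IsCumulantSeq.factorialMoment_apply_two [IsProbabilityMeasure μ] {f : ℕ → ℝ}
    (hf : IsCumulantSeq (fun k => factorialMoment X k μ) f)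
    (h : ∀ k : ℕ, Integrable (fun ω => X ω ^ k) μ) (hX : MemLp X 2 μ) :
    f 2 = Var[X; μ] - ∫ ω, X ω ∂μ := by
  have h1 := hf.2 1
  have h0 := hf.1
  simp only at h0 h1
  rw [Finset.sum_range_succ, Finset.sum_range_one] at h1
  simp only [h0, zero_add, Nat.sub_zero, Nat.sub_self, factorialMoment_one,
    hf.factorialMoment_apply_one] at h1
  have h2 : factorialMoment X (1 + 1) μ = (∫ ω, X ω ^ 2 ∂μ) - ∫ ω, X ω ∂μ := by
    have hX1 : Integrable X μ := by simpa using h 1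
    rw [factorialMoment, ← integral_sub (h 2) hX1]
    congr 1
    ext ω
    rw [descPochhammer_succ_eval]
    simp
    ring
  rw [h2] at h1
  rw [variance_eq_sub hX]
  simp at h1
  simp
  linarith

/-- Rescaled factorial moments and rescaled moments have the same limits. -/
lemma tendsto_integral_pow_of_tendsto_factorialMoment {Ω : ℕ → Type*} [∀ n, MeasurableSpace (Ω n)]
    {μ : ∀ n, Measure (Ω n)} {Y : ∀ n, Ω n → ℝ} {δ : ℕ → ℝ} {g : ℕ → ℝ}
    (hY : ∀ᶠ n in atTop, ∀ k : ℕ, Integrable (fun ω => Y n ω ^ k) (μ n))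
    (hδ : Tendsto δ atTop (𝓝 0))
    (h : ∀ m, Tendsto (fun n => δ n ^ m * factorialMoment (Y n) m (μ n)) atTop (𝓝 (g m))) (a : ℕ) :
    Tendsto (fun n => ∫ ω, (δ n * Y n ω) ^ a ∂(μ n)) atTop (𝓝 (g a)) := by
  -- Trade powers for falling factorials one at a time: `Y * (Y)_m = (Y)_{m+1} + m * (Y)_m`, where
  -- the last term keeps a spare factor `δ → 0`. The induction needs all `m` at once.
  have key : ∀ a m, Tendsto (fun n => ∫ ω, (δ n * Y n ω) ^ a *
      (δ n ^ m * (descPochhammer ℝ m).eval (Y n ω)) ∂(μ n)) atTop (𝓝 (g (a + m))) := by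
    intro a
    induction a with
    | zero =>
      intro m
      simpa [integral_const_mul, factorialMoment] using h m
    | succ a ih =>
      intro m
      have h1 := (ih (m + 1)).add ((hδ.const_mul (m : ℝ)).mul (ih m))
      rw [mul_zero, zero_mul, add_zero, show a + (m + 1) = a + 1 + m by ring] at h1
      refine h1.congr' (hY.mono fun n hn => ?_)
      have hint : ∀ m, Integrable (fun ω => (δ n * Y n ω) ^ a *
          (δ n ^ m * (descPochhammer ℝ m).eval (Y n ω))) (μ n) := by
        intro m
        have := integrable_eval_of_integrable_pow hn ((Polynomial.C (δ n) * Polynomial.X) ^ a *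
          (Polynomial.C (δ n ^ m) * descPochhammer ℝ m))
        simpa using this
      rw [← integral_const_mul, ← integral_add (hint _) ((hint m).const_mul _)]
      congr 1
      ext ω
      rw [descPochhammer_succ_eval]
      ring
  simpa using key a 0

end FactorialMoments

/-! ### Gaussian moments and the method of moments. -/

/-- The moments of the standard normal distribution. -/
noncomputable def gaussianMoment : ℕ → ℝ
  | 0 => 1
  | 1 => 0
  | n + 2 => (n + 1) * gaussianMoment n

lemma isCumulantSeq_gaussianMoment :
    IsCumulantSeq gaussianMoment (fun k => if k = 2 then 1 else 0) := by
  refine ⟨rfl, fun n => ?_⟩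
  cases n with
  | zero => simp [gaussianMoment]
  | succ n =>
    rw [Finset.sum_eq_single 1]
    · simp [gaussianMoment]
    · intro k _ hk
      simp [hk]
    · simp

/-- Along the segment `s * y`, the derivative of each Taylor remainder is `y * I` times the previous
one, so the bounds integrate inductively from `‖exp (i s y)‖ = 1`. -/
lemma norm_cexp_mul_I_sub_sum_le (y : ℝ) (n : ℕ) :
    ‖Complex.exp (y * Complex.I) - ∑ k ∈ Finset.range n, (y * Complex.I) ^ k / (k.factorial : ℂ)‖
      ≤ |y| ^ n / (n.factorial : ℝ) := by
  have key : ∀ s ∈ Set.Icc (0 : ℝ) 1, ‖Complex.exp (s * (y * Complex.I)) -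
      ∑ k ∈ Finset.range n, (s * (y * Complex.I)) ^ k / (k.factorial : ℂ)‖
      ≤ (s * |y|) ^ n / (n.factorial : ℝ) := by
    induction n with
    | zero =>
      intro s _
      have := Complex.norm_exp_ofReal_mul_I (s * y)
      push_cast at this
      rw [mul_assoc] at this
      simp [this]
    | succ n ih =>
      have hderiv : ∀ s : ℝ, HasDerivAt (fun s : ℝ => Complex.exp (s * (y * Complex.I)) -
          ∑ k ∈ Finset.range (n + 1), (s * (y * Complex.I)) ^ k / (k.factorial : ℂ))
          ((y * Complex.I) * (Complex.exp (s * (y * Complex.I)) -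
          ∑ k ∈ Finset.range n, (s * (y * Complex.I)) ^ k / (k.factorial : ℂ))) s := by
        intro s
        have h0 : HasDerivAt (fun s : ℝ => (s : ℂ) * (y * Complex.I)) (y * Complex.I) s := by
          simpa using (Complex.ofRealCLM.hasDerivAt (x := s)).mul_const (y * Complex.I)
        have h1 := h0.cexp
        have h2 : HasDerivAt (fun s : ℝ =>
            ∑ k ∈ Finset.range (n + 1), ((s : ℂ) * (y * Complex.I)) ^ k / (k.factorial : ℂ))
            (∑ k ∈ Finset.range (n + 1), ((k : ℂ) * ((s : ℂ) * (y * Complex.I)) ^ (k - 1) *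
              (y * Complex.I)) / (k.factorial : ℂ)) s :=
          HasDerivAt.fun_sum fun k _ => (h0.pow k).div_const _
        refine (h1.sub h2).congr_deriv ?_
        rw [Finset.sum_range_succ', mul_sub, Finset.mul_sum]
        simp only [Nat.cast_zero, zero_mul, zero_div, add_zero]
        congr 1
        · ring
        · refine Finset.sum_congr rfl fun k _ => ?_
          rw [Nat.factorial_succ]
          have h3 : (k.factorial : ℂ) ≠ 0 := by exact_mod_cast k.factorial_ne_zero
          have h4 : (k : ℂ) + 1 ≠ 0 := by exact_mod_cast k.succ_ne_zero
          push_cast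
          field_simp
      have hB : ∀ s : ℝ, HasDerivAt (fun s : ℝ => (s * |y|) ^ (n + 1) / ((n + 1).factorial : ℝ))
          (|y| * ((s * |y|) ^ n / (n.factorial : ℝ))) s := by
        intro s
        have h0 : HasDerivAt (fun s : ℝ => s * |y|) |y| s := by
          simpa using (hasDerivAt_id s).mul_const |y|
        refine ((h0.pow (n + 1)).div_const ((n + 1).factorial : ℝ)).congr_deriv ?_
        rw [Nat.factorial_succ]
        have h3 : (n.factorial : ℝ) ≠ 0 := by positivity
        push_cast
        field_simp
      refine image_norm_le_of_norm_deriv_right_le_deriv_boundary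
        (fun s _ => (hderiv s).continuousAt.continuousWithinAt)
        (fun s _ => (hderiv s).hasDerivWithinAt) ?_ hB fun s hs => ?_
      · rw [Finset.sum_range_succ']
        simp
      · rw [norm_mul, norm_mul, Complex.norm_I, mul_one, Complex.norm_real, Real.norm_eq_abs]
        gcongr
        exact ih s ⟨hs.1, hs.2.le⟩
  simpa using key 1 (by simp)

/-- Stopping at the even order `2 * N` makes the error an ordinary moment rather than an absolute
one. -/
lemma norm_charFun_sub_sum_le {ν : Measure ℝ} [IsProbabilityMeasure ν]
    (h : ∀ k : ℕ, Integrable (fun x : ℝ => x ^ k) ν) (t : ℝ) (N : ℕ) :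
    ‖charFun ν t - ∑ k ∈ Finset.range (2 * N),
        (t * Complex.I) ^ k / (k.factorial : ℂ) * ((∫ x, x ^ k ∂ν : ℝ) : ℂ)‖ ≤
      t ^ (2 * N) / ((2 * N).factorial : ℝ) * ∫ x, x ^ (2 * N) ∂ν := by
  have h1 : ∀ k, Integrable (fun x : ℝ => ((t * x : ℝ) * Complex.I) ^ k / (k.factorial : ℂ)) ν := by
    intro k
    have : Integrable (fun x : ℝ =>
        (t * Complex.I) ^ k / (k.factorial : ℂ) * ((x ^ k : ℝ) : ℂ)) ν :=
      (h k).ofReal.const_mul _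
    refine this.congr (Eventually.of_forall fun x => ?_)
    push_cast
    ring
  have h2 : ∑ k ∈ Finset.range (2 * N),
        (t * Complex.I) ^ k / (k.factorial : ℂ) * ((∫ x, x ^ k ∂ν : ℝ) : ℂ) =
      ∫ x, ∑ k ∈ Finset.range (2 * N), ((t * x : ℝ) * Complex.I) ^ k / (k.factorial : ℂ) ∂ν := by
    rw [integral_finsetSum _ fun k _ => h1 k]
    refine Finset.sum_congr rfl fun k _ => ?_
    rw [← integral_complex_ofReal, ← integral_const_mul]
    congr 1
    ext x
    push_cast
    ring
  have h3 : Integrable (fun x : ℝ => Complex.exp ((t * x : ℝ) * Complex.I)) ν := by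
    refine (integrable_const (1 : ℝ)).mono' (by fun_prop) (Eventually.of_forall fun x => ?_)
    rw [Complex.norm_exp_ofReal_mul_I]
  have h4 : charFun ν t = ∫ x, Complex.exp ((t * x : ℝ) * Complex.I) ∂ν := by
    rw [charFun_apply_real]
    simp
  rw [h2, h4, ← integral_sub h3 (integrable_finsetSum _ fun k _ => h1 k), ← integral_const_mul]
  refine norm_integral_le_of_norm_le ((h (2 * N)).const_mul _) (Eventually.of_forall fun x => ?_)
  refine (norm_cexp_mul_I_sub_sum_le (t * x) (2 * N)).trans_eq ?_
  rw [(even_two_mul N).pow_abs, mul_pow]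
  ring

lemma gaussianMoment_two_mul (j : ℕ) :
    gaussianMoment (2 * j) = ((2 * j).factorial : ℝ) / (2 ^ j * (j.factorial : ℝ)) := by
  induction j with
  | zero => simp [gaussianMoment]
  | succ j ih =>
    rw [show 2 * (j + 1) = 2 * j + 2 by ring, gaussianMoment, ih, Nat.factorial_succ,
      Nat.factorial_succ, Nat.factorial_succ]
    push_cast
    have h3 : (j.factorial : ℝ) ≠ 0 := by positivity
    field_simp
    ring

lemma gaussianMoment_two_mul_add_one (j : ℕ) : gaussianMoment (2 * j + 1) = 0 := by
  induction j with
  | zero => simp [gaussianMoment]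
  | succ j ih => rw [show 2 * (j + 1) + 1 = 2 * j + 1 + 2 by ring, gaussianMoment, ih, mul_zero]

lemma sum_range_gaussianMoment (t : ℝ) (N : ℕ) :
    ∑ k ∈ Finset.range (2 * N),
        (t * Complex.I) ^ k / (k.factorial : ℂ) * (gaussianMoment k : ℂ) =
      ∑ j ∈ Finset.range N, (-(t : ℂ) ^ 2 / 2) ^ j / (j.factorial : ℂ) := by
  induction N with
  | zero => simp
  | succ N ih =>
    rw [show 2 * (N + 1) = 2 * N + 1 + 1 by ring, Finset.sum_range_succ, Finset.sum_range_succ,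
      Finset.sum_range_succ, ih, gaussianMoment_two_mul, gaussianMoment_two_mul_add_one, pow_mul,
      mul_pow, Complex.I_sq]
    have h1 : (N.factorial : ℂ) ≠ 0 := by exact_mod_cast N.factorial_ne_zero
    have h2 : ((2 * N).factorial : ℂ) ≠ 0 := by exact_mod_cast (2 * N).factorial_ne_zero
    push_cast
    rw [mul_zero, add_zero, div_pow, mul_neg_one]
    field_simp

lemma tendsto_zero_of_le_of_tendsto {u : ℕ → ℝ} {v : ℕ → ℕ → ℝ} {w : ℕ → ℝ} (hu : ∀ n, 0 ≤ u n)
    (huv : ∀ N, ∀ᶠ n in atTop, u n ≤ v N n) (hv : ∀ N, Tendsto (v N) atTop (𝓝 (w N)))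
    (hw : Tendsto w atTop (𝓝 0)) : Tendsto u atTop (𝓝 0) := by
  rw [Metric.tendsto_nhds]
  intro ε hε
  obtain ⟨N, hN⟩ := (hw.eventually_lt_const hε).exists
  filter_upwards [huv N, (hv N).eventually_lt_const hN] with n h1 h2
  rw [Real.dist_0_eq_abs, abs_of_nonneg (hu n)]
  exact h1.trans_lt h2

/-- For fixed `N` the Taylor error tends to `(t ^ 2 / 2) ^ N / N!` as `n → ∞`, and this tends to `0`
as `N → ∞`. Here `P` is the Taylor polynomial built from the moments and `A` its limit in `n`. -/
lemma tendsto_charFun_of_tendsto_gaussianMoment {ν : ℕ → Measure ℝ}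
    [∀ n, IsProbabilityMeasure (ν n)]
    (h : ∀ᶠ n in atTop, ∀ k : ℕ, Integrable (fun x : ℝ => x ^ k) (ν n))
    (hlim : ∀ k, Tendsto (fun n => ∫ x, x ^ k ∂(ν n)) atTop (𝓝 (gaussianMoment k))) (t : ℝ) :
    Tendsto (fun n => charFun (ν n) t) atTop (𝓝 (charFun (gaussianReal 0 1) t)) := by
  have hφ : charFun (gaussianReal 0 1) t = Complex.exp (-(t : ℂ) ^ 2 / 2) := by
    rw [charFun_gaussianReal]
    simp [neg_div]
  rw [tendsto_iff_norm_sub_tendsto_zero, hφ]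
  let A : ℕ → ℂ := fun N => ∑ j ∈ Finset.range N, (-(t : ℂ) ^ 2 / 2) ^ j / (j.factorial : ℂ)
  let P : ℕ → ℕ → ℂ := fun N n => ∑ k ∈ Finset.range (2 * N),
    (t * Complex.I) ^ k / (k.factorial : ℂ) * ((∫ x, x ^ k ∂(ν n) : ℝ) : ℂ)
  have hP : ∀ N, Tendsto (P N) atTop (𝓝 (A N)) := by
    intro N
    simp only [A, ← sum_range_gaussianMoment]
    exact tendsto_finsetSum _ fun k _ =>
      ((Complex.continuous_ofReal.tendsto _).comp (hlim k)).const_mul _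
  have hA : Tendsto A atTop (𝓝 (Complex.exp (-(t : ℂ) ^ 2 / 2))) := by
    rw [Complex.exp_eq_exp_ℂ]
    exact (NormedSpace.expSeries_div_hasSum_exp (-(t : ℂ) ^ 2 / 2)).tendsto_sum_nat
  have hR : ∀ N : ℕ, t ^ (2 * N) / ((2 * N).factorial : ℝ) * gaussianMoment (2 * N) =
      (t ^ 2 / 2) ^ N / (N.factorial : ℝ) := by
    intro N
    rw [gaussianMoment_two_mul, pow_mul, div_pow]
    have h1 : (N.factorial : ℝ) ≠ 0 := by positivity
    have h2 : ((2 * N).factorial : ℝ) ≠ 0 := by positivity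
    field_simp
  refine tendsto_zero_of_le_of_tendsto
    (v := fun N n => t ^ (2 * N) / ((2 * N).factorial : ℝ) * (∫ x, x ^ (2 * N) ∂(ν n)) +
      ‖P N n - A N‖ + ‖A N - Complex.exp (-(t : ℂ) ^ 2 / 2)‖)
    (w := fun N => (t ^ 2 / 2) ^ N / (N.factorial : ℝ) + 0 +
      ‖A N - Complex.exp (-(t : ℂ) ^ 2 / 2)‖)
    (fun n => norm_nonneg _) (fun N => h.mono fun n hn => ?_) (fun N => ?_) ?_
  · have h1 := norm_charFun_sub_sum_le hn t N
    have h2 := norm_sub_le_norm_sub_add_norm_sub (charFun (ν n) t) (P N n)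
      (Complex.exp (-(t : ℂ) ^ 2 / 2))
    have h3 := norm_sub_le_norm_sub_add_norm_sub (P N n) (A N) (Complex.exp (-(t : ℂ) ^ 2 / 2))
    linarith
  · rw [← hR]
    exact (((hlim (2 * N)).const_mul _).add
      (tendsto_iff_norm_sub_tendsto_zero.1 (hP N))).add tendsto_const_nhds
  · have h1 := FloorSemiring.tendsto_pow_div_factorial_atTop (t ^ 2 / 2)
    simpa using (h1.add_const 0).add (tendsto_iff_norm_sub_tendsto_zero.1 hA)

/-- The method of moments for the standard normal distribution. -/
lemma tendstoInDistribution_of_tendsto_gaussianMoment {Ω : ℕ → Type*}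
    [∀ n, MeasurableSpace (Ω n)] {μ : ∀ n, Measure (Ω n)} [∀ n, IsProbabilityMeasure (μ n)]
    {X : ∀ n, Ω n → ℝ} (hX : ∀ n, AEMeasurable (X n) (μ n))
    (h : ∀ᶠ n in atTop, ∀ k : ℕ, Integrable (fun ω => X n ω ^ k) (μ n))
    (hlim : ∀ k, Tendsto (fun n => ∫ ω, X n ω ^ k ∂(μ n)) atTop (𝓝 (gaussianMoment k))) :
    TendstoInDistribution X atTop (id : ℝ → ℝ) μ (gaussianReal 0 1) where
  forall_aemeasurable := hX
  aemeasurable_limit := aemeasurable_id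
  tendsto := by
    have := fun n => Measure.isProbabilityMeasure_map (hX n)
    refine ProbabilityMeasure.tendsto_iff_tendsto_charFun.2 fun t => ?_
    simp only [ProbabilityMeasure.coe_mk, Measure.map_id]
    refine tendsto_charFun_of_tendsto_gaussianMoment (h.mono fun n hn k => ?_) (fun k => ?_) t
    · exact (integrable_map_measure (by fun_prop) (hX n)).2 (hn k)
    · refine (hlim k).congr fun n => ?_
      rw [integral_map (hX n) (by fun_prop)]

/-! ### Normalisation and the limit theorem. -/

lemma integrable_sub_const_pow {Ω : Type*} [MeasurableSpace Ω] {μ : Measure Ω} {X : Ω → ℝ}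
    (h : ∀ k : ℕ, Integrable (fun ω => X ω ^ k) μ) (r : ℝ) (k : ℕ) :
    Integrable (fun ω => (X ω - r) ^ k) μ :=
  (integrable_eval_of_integrable_pow h ((Polynomial.X - Polynomial.C r) ^ k)).congr
    (ae_of_all _ fun ω => by simp)

/-- Disposes of the terms that centring adds to the cumulants of order at least three: three factors
`1 / σ` are absorbed by `hm`, and any others stay bounded. -/
lemma tendsto_inv_sqrt_pow_mul_of_tendsto {v m : ℕ → ℝ} (hv0 : ∀ n, 0 ≤ v n)
    (hv : Tendsto v atTop atTop)
    (hm : Tendsto (fun n => m n / v n ^ (3 / 2 : ℝ)) atTop (𝓝 0)) {k : ℕ} (hk : 3 ≤ k) :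
    Tendsto (fun n => (√(v n))⁻¹ ^ k * m n) atTop (𝓝 0) := by
  have hδ : Tendsto (fun n => (√(v n))⁻¹) atTop (𝓝 0) :=
    (Real.tendsto_sqrt_atTop.comp hv).inv_tendsto_atTop
  have h1 := (hδ.pow (k - 3)).mul hm
  rw [mul_zero] at h1
  refine h1.congr fun n => ?_
  have h2 : v n ^ (3 / 2 : ℝ) = √(v n) ^ 3 := by
    rw [Real.rpow_div_two_eq_sqrt _ (hv0 n)]
    exact_mod_cast Real.rpow_natCast (√(v n)) 3
  obtain ⟨j, rfl⟩ := Nat.exists_eq_add_of_le' hk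
  rw [h2, Nat.add_sub_cancel, pow_add, div_eq_mul_inv, ← inv_pow]
  ring

lemma tendsto_inv_sqrt_pow_mul_of_abs_le {v L f : ℕ → ℝ} {k : ℕ} {K : ℝ} (hv0 : ∀ n, 0 ≤ v n)
    (hf : ∀ᶠ n : ℕ in atTop, |f n| ≤ K * |L n ^ k / (n : ℝ) ^ (k - 1)|)
    (hL : Tendsto (fun n : ℕ => L n ^ k / ((n : ℝ) ^ (k - 1) * v n ^ ((k : ℝ) / 2)))
        atTop (𝓝 0)) :
    Tendsto (fun n => (√(v n))⁻¹ ^ k * f n) atTop (𝓝 0) := by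
  have h1 := hL.abs.const_mul K
  rw [abs_zero, mul_zero] at h1
  refine squeeze_zero_norm' (hf.mono fun n hn => ?_) h1
  have h2 : v n ^ ((k : ℝ) / 2) = √(v n) ^ k := by
    rw [Real.rpow_div_two_eq_sqrt _ (hv0 n), Real.rpow_natCast]
  have hδ : 0 ≤ (√(v n))⁻¹ ^ k := by positivity
  rw [norm_mul, Real.norm_eq_abs, Real.norm_eq_abs, abs_of_nonneg hδ, h2, ← div_div,
    div_eq_mul_inv _ (√(v n) ^ k), abs_mul, ← inv_pow, abs_of_nonneg hδ]
  calc _ ≤ (√(v n))⁻¹ ^ k * (K * |L n ^ k / (n : ℝ) ^ (k - 1)|) := by gcongr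
    _ = _ := by ring

/-- The sequence is `S 1, S 2, …`; each `S n` may live on its own probability space. The summation
index `j` of the series below is shifted by one, so that `j + 1` runs over `1, 2, …`. -/
theorem mainTheorem1
    {Ω : ℕ → Type*} [∀ n, MeasurableSpace (Ω n)]
    (μ : ∀ n, Measure (Ω n)) [∀ n, IsProbabilityMeasure (μ n)]
    (S : ∀ n, Ω n → ℝ)
    (hS : ∀ n, AEMeasurable (S n) (μ n))
    -- all moments (equivalently, all factorial moments) are finite
    (hmom : ∀ n, 1 ≤ n → ∀ k : ℕ, MemLp (S n) (k : ℝ≥0∞) (μ n))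
    (hvar : Tendsto (fun n => Var[S n; μ n]) atTop atTop)
    (hmean : Tendsto (fun n => (∫ ω, S n ω ∂(μ n)) / Var[S n; μ n] ^ (3 / 2 : ℝ)) atTop (𝓝 0))
    (L : ℕ → ℝ) (Q : ℕ → ℕ → Polynomial ℝ) (C : ℝ) (hC : 0 < C)
    (hdeg : ∀ n, 1 ≤ n → ∀ j, 2 ≤ j → (Q n j).natDegree ≤ j)
    -- the case `i = 0` says that the constant term of `Q n j` vanishes
    (hbound : ∀ n, 1 ≤ n → ∀ j, 2 ≤ j → ∀ i : ℕ, |(Q n j).eval (i : ℝ)| ≤ (C * i) ^ j)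
    -- the series converges absolutely for all `n > C * i`, by `hbound`
    (hfact : ∀ i : ℕ, 1 ≤ i → ∀ᶠ n : ℕ in atTop,
      factorialMoment (S n) i (μ n) =
        L n ^ i * Real.exp
          (∑' j : ℕ, (Q n (j + 2)).eval (i : ℝ) / (((j : ℝ) + 1) * (n : ℝ) ^ (j + 1))))
    (hL : ∀ J : ℕ, 3 ≤ J →
      Tendsto (fun n : ℕ => L n ^ J / ((n : ℝ) ^ (J - 1) * Var[S n; μ n] ^ ((J : ℝ) / 2)))
        atTop (𝓝 0)) :
    TendstoInDistribution
      (fun n ω => (S n ω - ∫ ω', S n ω' ∂(μ n)) / √(Var[S n; μ n]))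
      atTop (id : ℝ → ℝ) μ (gaussianReal 0 1) := by
  have hint : ∀ n, 1 ≤ n → ∀ k : ℕ, Integrable (fun ω => S n ω ^ k) (μ n) :=
    fun n hn => integrable_pow_of_memLp (hmom n hn)
  have hintY : ∀ n, 1 ≤ n → ∀ k : ℕ,
      Integrable (fun ω => (S n ω - ∫ ω', S n ω' ∂(μ n)) ^ k) (μ n) :=
    fun n hn => integrable_sub_const_pow (hint n hn) _
  have hv0 : ∀ n, 0 ≤ Var[S n; μ n] := fun n => variance_nonneg _ _
  have hδ : Tendsto (fun n => (√(Var[S n; μ n]))⁻¹) atTop (𝓝 0) :=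
    (Real.tendsto_sqrt_atTop.comp hvar).inv_tendsto_atTop
  choose f hf using fun n => exists_isCumulantSeq (c := fun k => factorialMoment (S n) k (μ n))
    factorialMoment_zero
  have hfact_lim : ∀ m, Tendsto (fun n => (√(Var[S n; μ n]))⁻¹ ^ m *
      factorialMoment (fun ω => S n ω - ∫ ω', S n ω' ∂(μ n)) m (μ n)) atTop
      (𝓝 (gaussianMoment m)) := by
    refine tendsto_of_tendsto_cumulant ((eventually_ge_atTop 1).mono fun n hn =>
      ((hf n).factorialMoment_sub_const (hint n hn) (∫ ω', S n ω' ∂(μ n))).scale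
        (√(Var[S n; μ n]))⁻¹) isCumulantSeq_gaussianMoment fun k hk => ?_
    -- Centring cancels the first cumulant. The second is `Var - mean` before centring, which
    -- restores the mean and leaves exactly `Var`. From order three on, both contributions vanish in
    -- the limit.
    rcases (by omega : k = 1 ∨ k = 2 ∨ 3 ≤ k) with rfl | rfl | hk3
    · simp [(hf _).factorialMoment_apply_one]
    · refine tendsto_const_nhds.congr' ?_
      filter_upwards [eventually_ge_atTop 1, hvar.eventually_gt_atTop 0] with n hn hpos
      have h2 : MemLp (S n) 2 (μ n) := by exact_mod_cast hmom n hn 2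
      rw [(hf n).factorialMoment_apply_two (hint n hn) h2, inv_pow, Real.sq_sqrt hpos.le]
      simp [hpos.ne']
    · obtain ⟨K, hK⟩ := exists_abs_cumulant_le hC (fun n _ => hf n) hdeg hbound hfact k hk
      have h1 := tendsto_inv_sqrt_pow_mul_of_abs_le hv0 hK (hL k hk3)
      have h2 := (tendsto_inv_sqrt_pow_mul_of_tendsto hv0 hvar hmean hk3).mul_const
        ((-1) ^ (k - 1) * ((k - 1).factorial : ℝ))
      have h3 := h1.sub h2
      rw [zero_mul, sub_zero] at h3
      rw [if_neg (by omega)]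
      refine h3.congr fun n => ?_
      ring
  have hX : ∀ n ω, (S n ω - ∫ ω', S n ω' ∂(μ n)) / √(Var[S n; μ n]) =
      (√(Var[S n; μ n]))⁻¹ * (S n ω - ∫ ω', S n ω' ∂(μ n)) := fun n ω => by
    rw [div_eq_mul_inv, mul_comm]
  simp only [hX]
  refine tendstoInDistribution_of_tendsto_gaussianMoment (fun n => ?_)
    ((eventually_ge_atTop 1).mono fun n hn k => ?_)
    (tendsto_integral_pow_of_tendsto_factorialMoment
      ((eventually_ge_atTop 1).mono hintY) hδ hfact_lim)
  · exact ((hS n).sub_const _).const_mul _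
  · simp_rw [mul_pow]
    exact (hintY n hn k).const_mul _
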